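/- Fix $n\ge 1$, let $e_1,\dots,e_{n+1}$ be the standard basis of $\mathbb{Z}^{n+1}$, and put $\alpha_{ij}=e_i-e_{j+1}$ for $1\le i\le j\le n$ and $\alpha_i=\alpha_{ii}$. A Kostant picture of height $(\eta_1,\dots,\eta_n)\in\mathbb{N}^n$ is a family $(c_{ij})_{1\le i\le j\le n}$ of non-negative integers with $\sum_{i\le j}c_{ij}\alpha_{ij}=\sum_{i=1}^n\eta_i\alpha_i$ (it is drawn on $n$ ordered vertices, with $c_{ij}$ loops around the vertices $i$ through $j$). Let $L[\eta_1,\dots,\eta_n]$ be the natural logarithm of the number of Kostant pictures of height $(\eta_1,\dots,\eta_n)$, and let $L[h,w]=L[h,\dots,h]$ ($w$ entries). For functions $f,g$ of a positive integer, $f\succ g$ means $g/f\to 0$, and $f\sim g$ means $f/g\to 1$. There is a real constant $\gamma_+>0$ (the universal constant of the rectangular case) with the following two properties. 1. $L[h(x),w(x)]\sim\gamma_+\,w(x)\sqrt{h(x)}$ for all $h,w:\mathbb{Z}^+\to\mathbb{Z}^+$ with $w\succ\sqrt h\succ 1$. (This determines $\gamma_+$.) 2. Let $\eta:\mathbb{Z}^+\to\mathbb{Z}^+$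 be a non-decreasing function such that $n\succ\sqrt{\eta(n)}\succ 1$ and $\sum_{i=1}^n\sqrt{\eta(i)}\succ\eta(n)$. Then $$L[\eta(1),\eta(2),\dots,\eta(n)]\sim\gamma_+\sum_{i=1}^n\sqrt{\eta(i)}\qquad(n\to\infty).$$ -/

import Mathlib

open Filter Asymptotics

namespace Kostant

/-- A loop on `n` ordered vertices: it goes around the consecutive vertices `i, i + 1, …, j`, `i ≤ j`. -/
abbrev Loop (n : ℕ) : Type := {p : Fin n × Fin n // p.1 ≤ p.2}

/-- The root `α_{ij} = e_i - e_{j+1}` in `ℤ^{n+1}` which is represented by the loop around the vertices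
`i` through `j`. -/
def root {n : ℕ} (p : Loop n) : Fin (n + 1) → ℤ :=
  Pi.single p.1.1.castSucc 1 - Pi.single p.1.2.succ 1

/-- The simple root `α_i = α_{ii}`. -/
def simpleRoot {n : ℕ} (i : Fin n) : Fin (n + 1) → ℤ :=
  root ⟨(i, i), le_rfl⟩

/-- A Kostant picture for the weight `ν` is a finite collection of (indistinguishable) loops, given by
the number `mult p` of copies of each loop `p`, such that the sum of the corresponding roots is `ν`. -/
@[ext]
structure Picture {n : ℕ} (ν : Fin (n + 1) → ℤ) where
  mult : Loop n → ℕ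
  sum_eq : ∑ p, mult p • root p = ν

/-- The sum of the first `i` coordinates of a root is one if the loop contains the `i`-th vertex, and
zero otherwise. -/
theorem sum_root {n : ℕ} (p : Loop n) (i : Fin n) :
    ∑ k ∈ Finset.Iic i.castSucc, root p k = if p.1.1 ≤ i ∧ i ≤ p.1.2 then 1 else 0 := by
  have hp : p.1.1 ≤ p.1.2 := p.2
  simp only [root, Pi.sub_apply, Finset.sum_sub_distrib, Finset.sum_pi_single', Finset.mem_Iic,
    Fin.le_def, Fin.val_castSucc, Fin.val_succ] at hp ⊢
  split_ifs <;> first | rfl | omega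

/-- There are only finitely many Kostant pictures for a given weight, so that counting them by
`Nat.card` makes sense. -/
instance finite_picture {n : ℕ} (ν : Fin (n + 1) → ℤ) : Finite (Picture ν) := by
  have key : ∀ (P : Picture ν) (p : Loop n),
      (P.mult p : ℤ) ≤ ∑ k ∈ Finset.Iic p.1.1.castSucc, ν k := by
    intro P p
    have hν : ∑ k ∈ Finset.Iic p.1.1.castSucc, ν k
        = ∑ q, (P.mult q : ℤ) * (if q.1.1 ≤ p.1.1 ∧ p.1.1 ≤ q.1.2 then 1 else 0) := by
      simp_rw [← P.sum_eq, Finset.sum_apply, Pi.smul_apply, nsmul_eq_mul]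
      rw [Finset.sum_comm]
      exact Finset.sum_congr rfl fun q _ => by rw [← Finset.mul_sum, sum_root]
    rw [hν]
    refine le_trans (by simp [p.2])
      (Finset.single_le_sum (f := fun q : Loop n =>
        (P.mult q : ℤ) * (if q.1.1 ≤ p.1.1 ∧ p.1.1 ≤ q.1.2 then 1 else 0))
        (fun q _ => by positivity) (Finset.mem_univ p))
  refine Finite.of_injective
    (fun P : Picture ν => fun p : Loop n =>
      (⟨P.mult p, by have := key P p; omega⟩ :
        Fin ((∑ k ∈ Finset.Iic p.1.1.castSucc, ν k).toNat + 1))) ?_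
  intro P Q h
  ext p
  exact congrArg Fin.val (congrFun h p)

/-- Kostant's partition function: the number of Kostant pictures for the weight `ν`. -/
noncomputable def partitionFunction {n : ℕ} (ν : Fin (n + 1) → ℤ) : ℕ :=
  Nat.card (Picture ν)

/-- The weight `∑ η_i α_i` of height `η = (η_1, …, η_n)`. -/
def weightOfHeight {n : ℕ} (η : Fin n → ℕ) : Fin (n + 1) → ℤ :=
  ∑ i, η i • simpleRoot i

/-- `L[η]`: the natural logarithm of the number of Kostant pictures of height `η`. -/
noncomputable def logCount {n : ℕ} (η : Fin n → ℕ) : ℝ :=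
  Real.log (partitionFunction (weightOfHeight η))

/-- `L[h, w]`: the case of the constant height `h` on `w` vertices. -/
noncomputable def rectLogCount (h w : ℕ) : ℝ :=
  logCount (fun _ : Fin w => h)

/-- `L[η]_n = L[η(1), …, η(n)]`: the vertex with the zero-based index `i` has height `η(i + 1)`. -/
noncomputable def initialLogCount (η : ℕ+ → ℕ+) (n : ℕ+) : ℝ :=
  logCount (fun i : Fin n => (η (Nat.succPNat i) : ℕ))

/-- The property that characterizes the universal constant `γ₊`: it is positive, and
`L[h, w] ∼ γ₊ w √h` for all positive integer functions `h`, `w` with `w ≻ √h ≻ 1`. -/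
def IsGammaPlus (γ : ℝ) : Prop :=
  0 < γ ∧ ∀ h w : ℕ+ → ℕ+,
    ((fun _ => (1 : ℝ)) =o[atTop] fun x => √(h x : ℝ)) →
    ((fun x => √(h x : ℝ)) =o[atTop] fun x => (w x : ℝ)) →
    (fun x => rectLogCount (h x) (w x)) ~[atTop] fun x => γ * (w x : ℝ) * √(h x : ℝ)

end Kostant

/-!
The constant is `γ₊ = 2 √ζ(2) = π √(2/3)`. A Kostant picture of height `η` is the same thing as a
multiplicity function on loops in which every vertex `k` is covered `η k` times, and both bounds come
from the entropy of independent geometric multiplicities.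

*Upper bound.* The number of pictures is a coefficient of the generating function
`∏ p, (1 - ∏ k ∈ p, z k)⁻¹`, hence is at most `∏ k, z k ^ (-η k)` times its value at any
`z k = exp (-lam k)` (`logCount_le`). For non-decreasing `η` the choice `lam k = √ζ(2) / √(η k)` gives
`L[η] ≤ γ₊ ∑ √(η k)` without any error term (`logCount_le_gammaPlus_mul`): the loops that end at a
vertex `j` contribute at most the logarithm of the generating function of partitions at
`exp (-lam j)`, that is, at most `ζ(2) / lam j`.

*Lower bound.* Loops around a single vertex can raise any height, so it suffices to construct families
of loops whose coverage is at most `η`. A block of `M` cells of `s` vertices each is considered, with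
`s` a small multiple of `√h`, and the number of loops from one cell to another is prescribed to be
`⌊s² / (exp ((m + 1) τ) - 1)⌋` if they are `m > 0` cells apart. The coverage is then at most `h`
whatever the position of the loops, and the position of the loops is free, so that the families are
counted by a product of binomial coefficients (`sum_log_multichoose_le_logCount`). By Stirling's
formula its logarithm is a Riemann sum for `∫ (-log (1 - exp (-x)) + x / (exp x - 1)) = 2 ζ(2)`
(`exists_entropy_sum_ge`), which yields almost `γ₊ √h` per vertex on a block of length `O(√h)`
(`exists_block`).

For a non-decreasing height, blocks are put side by side, each adapted to its first height. A block
from `i` to `j` loses at most `O(√(η i)) * (√(η j) - √(η i)) = O(η j - η i)`, and these differences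
telescope to `O(η n)` (`mul_sum_sqrt_le_of_blocks`), which is negligible by hypothesis. The rectangular
case is that of a constant `η`.
-/

namespace Kostant

open scoped Nat Topology

/-! ### Pictures and coverage -/

/-- The total multiplicity in `c` of the loops that contain the vertex `k`. -/
def coverage {n : ℕ} (c : Loop n → ℕ) (k : Fin n) : ℕ :=
  ∑ p : Loop n, if p.1.1 ≤ k ∧ k ≤ p.1.2 then c p else 0

theorem sum_Iic_sum_smul_root {n : ℕ} (c : Loop n → ℕ) (k : Fin n) :
    ∑ t ∈ Finset.Iic k.castSucc, (∑ p, c p • root p) t = coverage c k := by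
  simp_rw [Finset.sum_apply, Pi.smul_apply, nsmul_eq_mul]
  rw [Finset.sum_comm, coverage, Nat.cast_sum]
  refine Finset.sum_congr rfl fun q _ => ?_
  rw [← Finset.mul_sum, sum_root]
  split_ifs <;> simp

/-- A root is the sum of the simple roots of the vertices in its loop. -/
theorem root_eq_sum_simpleRoot {n : ℕ} (p : Loop n) :
    root p = ∑ k, if p.1.1 ≤ k ∧ k ≤ p.1.2 then simpleRoot k else 0 := by
  obtain ⟨⟨a, b⟩, hab⟩ := p
  obtain ⟨b, hb⟩ := b
  dsimp only at hab ⊢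
  induction b with
  | zero =>
    have ha : a = ⟨0, hb⟩ := le_antisymm hab (Fin.mk_le_of_le_val (Nat.zero_le _))
    subst ha
    rw [Finset.sum_eq_single ⟨0, hb⟩]
    · simp [simpleRoot]
    · intro k _ hk
      rw [if_neg]
      exact fun h => hk (le_antisymm h.2 h.1)
    · simp
  | succ b ih =>
    rcases hab.lt_or_eq with h | h
    · have h' : a ≤ ⟨b, by omega⟩ := by
        rw [Fin.lt_def] at h
        rw [Fin.le_def]
        exact Nat.le_of_lt_succ h
      have hs : root ⟨(a, ⟨b + 1, hb⟩), hab⟩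
          = root ⟨(a, ⟨b, by omega⟩), h'⟩ + simpleRoot ⟨b + 1, hb⟩ := by
        simp only [root, simpleRoot, Fin.succ_mk, Fin.castSucc_mk]
        abel
      rw [hs, ih (by omega) h']
      have : simpleRoot ⟨b + 1, hb⟩
          = ∑ k, if k = ⟨b + 1, hb⟩ then simpleRoot k else 0 := by simp
      rw [this, ← Finset.sum_add_distrib]
      refine Finset.sum_congr rfl fun k _ => ?_
      simp only [Fin.le_def, Fin.ext_iff] at h' ⊢
      split_ifs <;> first | (exfalso; omega) | simp
    · subst h
      rw [Finset.sum_eq_single ⟨b + 1, hb⟩]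
      · simp [simpleRoot]
      · intro k _ hk
        rw [if_neg]
        exact fun h => hk (le_antisymm h.2 h.1)
      · simp

/-- The sum of the roots of a family of loops has the coverage of the family as its height. -/
theorem sum_smul_root {n : ℕ} (c : Loop n → ℕ) :
    ∑ p, c p • root p = weightOfHeight (coverage c) := by
  simp_rw [root_eq_sum_simpleRoot, weightOfHeight, coverage, Finset.sum_smul, Finset.smul_sum]
  rw [Finset.sum_comm]
  refine Finset.sum_congr rfl fun k _ => Finset.sum_congr rfl fun p _ => ?_
  split_ifs <;> simp

theorem sum_Iic_weightOfHeight {n : ℕ} (η : Fin n → ℕ) (k : Fin n) :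
    ∑ t ∈ Finset.Iic k.castSucc, weightOfHeight η t = η k := by
  simp_rw [weightOfHeight, Finset.sum_apply, Pi.smul_apply, nsmul_eq_mul]
  rw [Finset.sum_comm, Finset.sum_eq_single k]
  · rw [← Finset.mul_sum, simpleRoot, sum_root]
    simp
  · intro i _ hi
    rw [← Finset.mul_sum, simpleRoot, sum_root, if_neg, mul_zero]
    exact fun h => hi (le_antisymm h.1 h.2)
  · simp

theorem Picture.coverage_mult {n : ℕ} {η : Fin n → ℕ} (P : Picture (weightOfHeight η))
    (k : Fin n) : coverage P.mult k = η k := by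
  have := sum_Iic_sum_smul_root P.mult k
  rw [P.sum_eq, sum_Iic_weightOfHeight] at this
  exact_mod_cast this.symm

theorem card_le_partitionFunction {n : ℕ} {η : Fin n → ℕ} {X : Type*} (f : X → Loop n → ℕ)
    (hf : Function.Injective f) (hη : ∀ x, coverage (f x) = η) :
    Nat.card X ≤ partitionFunction (weightOfHeight η) := by
  refine Nat.card_le_card_of_injective
    (fun x => (⟨f x, by rw [sum_smul_root, hη]⟩ : Picture (weightOfHeight η))) fun x y h => hf ?_
  exact congrArg Picture.mult h

/-- The loops around a single vertex can be used to raise all heights to prescribed values, so that a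
lower bound for the number of pictures needs only an upper bound for the coverage. -/
theorem card_le_partitionFunction_of_le {n : ℕ} {η : Fin n → ℕ} {X : Type*}
    (f : X → Loop n → ℕ) (hf : Function.Injective f) (hη : ∀ x k, coverage (f x) k ≤ η k)
    (h0 : ∀ x (p : Loop n), p.1.1 = p.1.2 → f x p = 0) :
    Nat.card X ≤ partitionFunction (weightOfHeight η) := by
  refine card_le_partitionFunction
    (fun x p => f x p + if p.1.1 = p.1.2 then η p.1.1 - coverage (f x) p.1.1 else 0) ?_ ?_
  · intro x y hxy
    refine hf (funext fun p => ?_)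
    by_cases hp : p.1.1 = p.1.2
    · rw [h0 x p hp, h0 y p hp]
    · have := congrFun hxy p
      simpa [hp] using this
  · intro x
    funext k
    have hsplit : coverage (fun p => f x p +
        if p.1.1 = p.1.2 then η p.1.1 - coverage (f x) p.1.1 else 0) k
        = coverage (f x) k + ∑ p : Loop n, if p.1.1 ≤ k ∧ k ≤ p.1.2 then
          (if p.1.1 = p.1.2 then η p.1.1 - coverage (f x) p.1.1 else 0) else 0 := by
      rw [coverage, coverage, ← Finset.sum_add_distrib]
      refine Finset.sum_congr rfl fun p _ => ?_
      split_ifs <;> simp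
    rw [hsplit, Finset.sum_eq_single ⟨(k, k), le_rfl⟩]
    · have := hη x k
      simp only [le_refl, and_self, if_true]
      omega
    · rintro ⟨⟨a, b⟩, hab⟩ _ hp
      split_ifs with h1 h2
      · dsimp only at h1 h2
        subst h2
        exact absurd (by simp [le_antisymm h1.1 h1.2]) hp
      · rfl
      · rfl
    · simp

theorem coverage_extend {n : ℕ} {T : Type*} [Fintype T] (ι : T → Loop n)
    (hι : Function.Injective ι) (d : T → ℕ) (k : Fin n) :
    coverage (Function.extend ι d 0) k
      = ∑ t, if (ι t).1.1 ≤ k ∧ k ≤ (ι t).1.2 then d t else 0 := by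
  refine (Fintype.sum_of_injective ι hι _ _ ?_ ?_).symm
  · intro p hp
    rw [Function.extend_apply' _ _ _ hp]
    simp
  · intro t
    rw [hι.extend_apply]

theorem partitionFunction_pos {n : ℕ} (η : Fin n → ℕ) :
    0 < partitionFunction (weightOfHeight η) := by
  have := card_le_partitionFunction_of_le (η := η) (fun (_ : Unit) _ => 0)
    (fun _ _ _ => rfl) (by simp [coverage]) (by simp)
  simpa [Nat.succ_le_iff] using this

theorem logCount_nonneg {n : ℕ} (η : Fin n → ℕ) : 0 ≤ logCount η :=
  Real.log_natCast_nonneg _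

/-- Pictures on two adjacent groups of vertices can be put side by side. -/
theorem partitionFunction_mul_le {m n : ℕ} (η : Fin (m + n) → ℕ) :
    partitionFunction (weightOfHeight fun i => η (Fin.castAdd n i))
        * partitionFunction (weightOfHeight fun i => η (Fin.natAdd m i))
      ≤ partitionFunction (weightOfHeight η) := by
  let ι : Loop m ⊕ Loop n → Loop (m + n) := Sum.elim
    (fun p => ⟨(Fin.castAdd n p.1.1, Fin.castAdd n p.1.2), p.2⟩)
    (fun p => ⟨(Fin.natAdd m p.1.1, Fin.natAdd m p.1.2), by
      have := p.2
      rw [Fin.le_def] at this ⊢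
      simpa using this⟩)
  have hι : Function.Injective ι := by
    rintro (⟨⟨a, b⟩, h⟩ | ⟨⟨a, b⟩, h⟩) (⟨⟨a', b'⟩, h'⟩ | ⟨⟨a', b'⟩, h'⟩) e <;>
    · simp only [ι, Sum.elim_inl, Sum.elim_inr, Subtype.mk.injEq, Prod.mk.injEq, Fin.ext_iff,
        Fin.val_castAdd, Fin.val_natAdd] at e
      first
      | omega
      | simp only [Sum.inl.injEq, Sum.inr.injEq, Subtype.mk.injEq, Prod.mk.injEq, Fin.ext_iff]
        omega
  rw [partitionFunction, partitionFunction, ← Nat.card_prod]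
  refine card_le_partitionFunction
    (fun x => Function.extend ι (Sum.elim x.1.mult x.2.mult) 0) ?_ ?_
  · rintro ⟨P, Q⟩ ⟨P', Q'⟩ e
    have e' : ∀ t, Sum.elim P.mult Q.mult t = Sum.elim P'.mult Q'.mult t := fun t => by
      have := congrFun e (ι t)
      simpa only [hι.extend_apply] using this
    refine Prod.ext (Picture.ext (funext fun p => e' (.inl p)))
      (Picture.ext (funext fun p => e' (.inr p)))
  · rintro ⟨P, Q⟩
    funext k
    rw [coverage_extend ι hι, Fintype.sum_sum_type]
    induction k using Fin.addCases with
    | left k =>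
      rw [Finset.sum_eq_zero (s := (Finset.univ : Finset (Loop n))), add_zero,
        ← P.coverage_mult k]
      · rfl
      · intro p _
        rw [if_neg]
        simp only [ι, Sum.elim_inr, Fin.le_def, Fin.val_natAdd, Fin.val_castAdd]
        omega
    | right k =>
      rw [Finset.sum_eq_zero (s := (Finset.univ : Finset (Loop m))), zero_add,
        ← Q.coverage_mult k]
      · refine Finset.sum_congr rfl fun p _ => ?_
        simp [ι]
      · intro p _
        rw [if_neg]
        simp only [ι, Sum.elim_inl, Fin.le_def, Fin.val_natAdd, Fin.val_castAdd]
        omega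

theorem logCount_add_le {m n : ℕ} (η : Fin (m + n) → ℕ) :
    (logCount fun i => η (Fin.castAdd n i)) + (logCount fun i => η (Fin.natAdd m i))
      ≤ logCount η := by
  have h1 := partitionFunction_pos fun i => η (Fin.castAdd n i)
  have h2 := partitionFunction_pos fun i => η (Fin.natAdd m i)
  rw [logCount, logCount, logCount, ← Real.log_mul (by positivity) (by positivity)]
  exact Real.log_le_log (by positivity) (by exact_mod_cast partitionFunction_mul_le η)

/-! ### Loops between the cells of a block -/

/-- Among the pairs of cells at distance `m`, at most `m + 1` have a given cell `k` in the range from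
the first to the second, both included. -/
theorem card_cells_containing_le (M m : ℕ) (k : Fin M) :
    (Finset.univ.filter fun e : {e : Fin M × Fin M // e.1 < e.2} =>
      (e.1.1 ≤ k ∧ k ≤ e.1.2) ∧ (e.1.2 - e.1.1 : ℕ) = m).card ≤ m + 1 := by
  rw [← Finset.card_range (m + 1)]
  refine Finset.card_le_card_of_injOn (fun e => (k - e.1.1 : ℕ)) ?_ ?_
  · rintro ⟨⟨a, b⟩, hab⟩ he
    simp only [Finset.coe_filter, Finset.mem_univ, true_and, Set.mem_ofPred_eq, Fin.le_def,
      Finset.coe_range, Set.mem_Iio] at he ⊢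
    omega
  · rintro ⟨⟨a, b⟩, hab⟩ he ⟨⟨a', b'⟩, hab'⟩ he' h
    simp only [Finset.coe_filter, Finset.mem_univ, true_and, Set.mem_ofPred_eq, Fin.le_def,
      Fin.lt_def] at he he' h hab hab'
    simp only [Subtype.mk.injEq, Prod.mk.injEq, Fin.ext_iff]
    omega

theorem le_card_cells (M m : ℕ) (hm : 0 < m) :
    M - m ≤ (Finset.univ.filter fun e : {e : Fin M × Fin M // e.1 < e.2} =>
      (e.1.2 - e.1.1 : ℕ) = m).card := by
  have h := Finset.card_le_card_of_injOn (s := (Finset.univ : Finset (Fin (M - m))))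
    (t := Finset.univ.filter fun e : {e : Fin M × Fin M // e.1 < e.2} =>
      (e.1.2 - e.1.1 : ℕ) = m)
    (fun a => ⟨(⟨a, by omega⟩, ⟨a + m, by omega⟩), by
      simp only [Fin.lt_def]
      omega⟩) (by intro a _; simp) (by
      intro a _ b _ hab
      simp only [Subtype.mk.injEq, Prod.mk.injEq, Fin.mk.injEq] at hab
      exact Fin.ext hab.1)
  simpa using h

/-- On `M` consecutive cells of `s` vertices each, prescribe for every pair of distinct cells, `m`
cells apart, the total number `N m` of loops from the first to the second: the loops from one cell to
the other can be chosen freely, and the coverage is bounded by `∑ m, (m + 1) * N m`. -/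
theorem prod_multichoose_le_partitionFunction (M s h : ℕ) (N : ℕ → ℕ)
    (hN : ∑ m ∈ Finset.Ico 1 M, (m + 1) * N m ≤ h) (η : Fin (M * s) → ℕ) (hη : ∀ i, h ≤ η i) :
    ∏ e : {e : Fin M × Fin M // e.1 < e.2}, (s * s).multichoose (N (e.1.2 - e.1.1))
      ≤ partitionFunction (weightOfHeight η) := by
  -- The vertex `i` of the cell `a` is the vertex `i + s * a` of the block.
  have hdiv : ∀ (a b : Fin M) (i j : Fin s), i + s * a ≤ j + s * b → a ≤ b := by
    intro a b i j hij
    by_contra! hba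
    have h1 : s * (b + 1) ≤ s * a := Nat.mul_le_mul_left s hba
    have h2 := j.2
    rw [mul_add] at h1
    omega
  have hlt : ∀ (a b : Fin M) (i j : Fin s), a < b → i + s * a ≤ j + s * b := by
    intro a b i j hab
    have h1 : s * (a + 1) ≤ s * b := Nat.mul_le_mul_left s hab
    have h2 := i.2
    rw [mul_add] at h1
    omega
  -- The loop from the vertex `t.2.1` of the cell `t.1.1.1` to the vertex `t.2.2` of the cell `t.1.1.2`.
  let ι : {e : Fin M × Fin M // e.1 < e.2} × (Fin s × Fin s) → Loop (M * s) := fun t =>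
    ⟨(finProdFinEquiv (t.1.1.1, t.2.1), finProdFinEquiv (t.1.1.2, t.2.2)), by
      rw [Fin.le_def]
      exact hlt _ _ _ _ t.1.2⟩
  have hι : Function.Injective ι := by
    rintro ⟨⟨⟨a, b⟩, hab⟩, i, j⟩ ⟨⟨⟨a', b'⟩, hab'⟩, i', j'⟩ e
    simp only [ι, Subtype.mk.injEq, Prod.mk.injEq, EmbeddingLike.apply_eq_iff_eq] at e
    obtain ⟨⟨rfl, rfl⟩, rfl, rfl⟩ := e
    rfl
  have hcard : ∏ e : {e : Fin M × Fin M // e.1 < e.2}, (s * s).multichoose (N (e.1.2 - e.1.1))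
      = Nat.card (∀ e : {e : Fin M × Fin M // e.1 < e.2},
          Sym (Fin s × Fin s) (N (e.1.2 - e.1.1))) := by
    rw [Nat.card_pi]
    refine Finset.prod_congr rfl fun e _ => ?_
    rw [Nat.card_eq_fintype_card, Sym.card_sym_eq_multichoose]
    simp
  rw [hcard]
  refine card_le_partitionFunction_of_le
    (fun x => Function.extend ι (fun t => (x t.1 : Multiset (Fin s × Fin s)).count t.2) 0) ?_ ?_ ?_
  · intro x y hxy
    funext e
    refine Sym.coe_injective (Multiset.ext.2 fun q => ?_)
    have := congrFun hxy (ι (e, q))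
    simpa only [hι.extend_apply] using this
  · intro x k
    refine le_trans ?_ (hN.trans (hη k))
    obtain ⟨⟨κ, r⟩, rfl⟩ := finProdFinEquiv.surjective k
    rw [coverage_extend ι hι, Fintype.sum_prod_type]
    calc ∑ e : {e : Fin M × Fin M // e.1 < e.2}, ∑ q : Fin s × Fin s,
          (if (ι (e, q)).1.1 ≤ finProdFinEquiv (κ, r) ∧ finProdFinEquiv (κ, r) ≤ (ι (e, q)).1.2
            then (x e : Multiset (Fin s × Fin s)).count q else 0)
        ≤ ∑ e : {e : Fin M × Fin M // e.1 < e.2},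
            if e.1.1 ≤ κ ∧ κ ≤ e.1.2 then N (e.1.2 - e.1.1) else 0 := by
          refine Finset.sum_le_sum fun e _ => ?_
          split_ifs with he
          · calc _ ≤ ∑ q : Fin s × Fin s, (x e : Multiset (Fin s × Fin s)).count q := by
                  refine Finset.sum_le_sum fun q _ => ?_
                  split_ifs
                  · exact le_rfl
                  · exact Nat.zero_le _
              _ = N (e.1.2 - e.1.1) := by
                  rw [Multiset.sum_count_eq_card (fun _ _ => Finset.mem_univ _)]
                  exact (x e).2
          · refine (Finset.sum_eq_zero fun q _ => if_neg fun hq => he ?_).le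
            exact ⟨hdiv _ _ _ _ hq.1, hdiv _ _ _ _ hq.2⟩
      _ = ∑ e ∈ Finset.univ.filter (fun e : {e : Fin M × Fin M // e.1 < e.2} =>
            e.1.1 ≤ κ ∧ κ ≤ e.1.2), N (e.1.2 - e.1.1) := (Finset.sum_filter _ _).symm
      _ = ∑ m ∈ Finset.Ico 1 M, ∑ e ∈ (Finset.univ.filter
            (fun e : {e : Fin M × Fin M // e.1 < e.2} => e.1.1 ≤ κ ∧ κ ≤ e.1.2)).filter
              (fun e => (e.1.2 - e.1.1 : ℕ) = m), N (e.1.2 - e.1.1) := by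
          refine (Finset.sum_fiberwise_of_maps_to (fun e _ => ?_) _).symm
          have := e.2
          have := e.1.2.2
          simp only [Finset.mem_Ico, Fin.lt_def] at *
          omega
      _ ≤ ∑ m ∈ Finset.Ico 1 M, (m + 1) * N m := by
          refine Finset.sum_le_sum fun m _ => ?_
          rw [Finset.filter_filter, Finset.sum_congr rfl (g := fun _ => N m)
            (fun e he => by rw [(Finset.mem_filter.1 he).2.2]), Finset.sum_const, smul_eq_mul]
          exact Nat.mul_le_mul_right _ (card_cells_containing_le M m κ)
  · intro x p hp
    by_cases h : ∃ t, ι t = p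
    · obtain ⟨⟨e, i, j⟩, rfl⟩ := h
      have h1 : e.1.1 = e.1.2 := by
        have := finProdFinEquiv.injective hp
        exact congrArg Prod.fst this
      exact absurd h1 e.2.ne
    · rw [Function.extend_apply' _ _ _ h]
      rfl

theorem sum_log_multichoose_le_logCount (M s h : ℕ) (N : ℕ → ℕ)
    (hN : ∑ m ∈ Finset.Ico 1 M, (m + 1) * N m ≤ h) (η : Fin (M * s) → ℕ) (hη : ∀ i, h ≤ η i)
    (hs : 0 < s) :
    ∑ m ∈ Finset.Ico 1 M, ((M : ℝ) - m) * Real.log ((s * s).multichoose (N m)) ≤ logCount η := by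
  have hpos : ∀ k, 0 < (s * s).multichoose k := fun k => by
    rw [Nat.multichoose_eq]
    have := Nat.mul_pos hs hs
    exact Nat.choose_pos (by omega)
  have h1 : Real.log (∏ e : {e : Fin M × Fin M // e.1 < e.2},
      (s * s).multichoose (N (e.1.2 - e.1.1)) : ℕ) ≤ logCount η :=
    Real.log_le_log (by exact_mod_cast Finset.prod_pos fun e _ => hpos _)
      (by exact_mod_cast prod_multichoose_le_partitionFunction M s h N hN η hη)
  refine le_trans ?_ h1
  rw [Nat.cast_prod, Real.log_prod (fun e _ => by exact_mod_cast (hpos _).ne'),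
    ← Finset.sum_fiberwise_of_maps_to (s := Finset.univ) (t := Finset.Ico 1 M)
      (g := fun e : {e : Fin M × Fin M // e.1 < e.2} => (e.1.2 - e.1.1 : ℕ))]
  · refine Finset.sum_le_sum fun m hm => ?_
    rw [Finset.sum_congr rfl (g := fun _ => Real.log ((s * s).multichoose (N m)))
      (fun e he => by rw [(Finset.mem_filter.1 he).2]), Finset.sum_const, nsmul_eq_mul]
    refine mul_le_mul_of_nonneg_right ?_ (Real.log_natCast_nonneg _)
    rw [Finset.mem_Ico] at hm
    rw [← Nat.cast_sub hm.2.le]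
    exact_mod_cast le_card_cells M m hm.1
  · intro e _
    have := e.2
    have := e.1.2.2
    simp only [Finset.mem_Ico, Fin.lt_def] at *
    omega

/-! ### The upper bound -/

theorem hasSum_one_div_succ_sq :
    HasSum (fun k : ℕ => 1 / ((k : ℝ) + 1) ^ 2) (Real.pi ^ 2 / 6) := by
  have := (hasSum_nat_add_iff' 1).2 hasSum_zeta_two
  simpa using this

theorem exp_neg_div_one_sub_le {x : ℝ} (hx : 0 < x) :
    Real.exp (-x) / (1 - Real.exp (-x)) ≤ 1 / x := by
  have h1 : Real.exp (-x) < 1 := by simpa using hx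
  rw [div_le_div_iff₀ (by linarith) hx, one_mul]
  have h2 : (x + 1) * Real.exp (-x) ≤ Real.exp x * Real.exp (-x) :=
    mul_le_mul_of_nonneg_right (Real.add_one_le_exp x) (Real.exp_pos _).le
  rw [← Real.exp_add, add_neg_cancel, Real.exp_zero] at h2
  nlinarith

theorem sum_range_exp_neg_mul_le {x : ℝ} (hx : 0 < x) (n : ℕ) :
    ∑ l ∈ Finset.range n, Real.exp (-(((l : ℝ) + 1) * x)) ≤ 1 / x := by
  have h1 : Real.exp (-x) < 1 := by simpa using hx
  refine le_trans ?_ (exp_neg_div_one_sub_le hx)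
  have h2 : ∀ l : ℕ, Real.exp (-(((l : ℝ) + 1) * x)) = Real.exp (-x) * Real.exp (-x) ^ l := by
    intro l
    rw [← Real.exp_nat_mul, ← Real.exp_add]
    ring_nf
  simp_rw [h2]
  rw [← Finset.mul_sum, div_eq_mul_inv]
  refine mul_le_mul_of_nonneg_left ?_ (Real.exp_pos _).le
  rw [← tsum_geometric_of_lt_one (Real.exp_pos _).le h1]
  exact (summable_geometric_of_lt_one (Real.exp_pos _).le h1).sum_le_tsum _
    fun _ _ => by positivity

theorem hasSum_neg_log_one_sub_exp_neg {x : ℝ} (hx : 0 < x) :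
    HasSum (fun k : ℕ => Real.exp (-(((k : ℝ) + 1) * x)) / ((k : ℝ) + 1))
      (-Real.log (1 - Real.exp (-x))) := by
  have h1 : Real.exp (-x) < 1 := by simpa using hx
  convert Real.hasSum_pow_div_log_of_abs_lt_one (x := Real.exp (-x))
    (by rwa [abs_of_pos (Real.exp_pos _)]) using 3 with k
  rw [← Real.exp_nat_mul]
  push_cast
  ring_nf

/-- Bound for the logarithm of a finite part of the generating function of partitions. -/
theorem sum_neg_log_one_sub_exp_neg_le {x : ℝ} (hx : 0 < x) (n : ℕ) :
    ∑ l ∈ Finset.range n, -Real.log (1 - Real.exp (-(((l : ℝ) + 1) * x)))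
      ≤ Real.pi ^ 2 / 6 / x := by
  have h1 := hasSum_sum (s := Finset.range n) fun l _ =>
    hasSum_neg_log_one_sub_exp_neg (x := ((l : ℝ) + 1) * x) (by positivity)
  refine hasSum_le (fun k => ?_) h1 (hasSum_one_div_succ_sq.div_const x)
  have h2 := sum_range_exp_neg_mul_le (x := ((k : ℝ) + 1) * x) (by positivity) n
  rw [← Finset.sum_div, div_le_iff₀ (by positivity)]
  calc _ = ∑ l ∈ Finset.range n, Real.exp (-(((l : ℝ) + 1) * (((k : ℝ) + 1) * x))) :=
        Finset.sum_congr rfl fun l _ => by ring_nf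
    _ ≤ _ := h2
    _ = _ := by field_simp

/-- The entropy bound: the partition function is a coefficient of the generating function
`∏ p, (1 - ∏ k ∈ p, z k)⁻¹`, which is evaluated here at `z k = exp (-lam k)`. -/
theorem logCount_le {n : ℕ} (η : Fin n → ℕ) (lam : Fin n → ℝ) (hlam : ∀ k, 0 < lam k) :
    logCount η ≤ ∑ p : Loop n,
        -Real.log (1 - Real.exp (-∑ k, if p.1.1 ≤ k ∧ k ≤ p.1.2 then lam k else 0))
      + ∑ k, lam k * η k := by
  classical
  -- All pictures of height `η` have the same weight `∏ p, exp (-Λ p) ^ mult p`.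
  set Λ : Loop n → ℝ := fun p => ∑ k, if p.1.1 ≤ k ∧ k ≤ p.1.2 then lam k else 0 with hΛ
  have hΛpos : ∀ p, 0 < Λ p := fun p => by
    refine Finset.sum_pos' (fun k _ => ?_) ⟨p.1.1, Finset.mem_univ _, ?_⟩
    · split_ifs
      · exact (hlam k).le
      · exact le_rfl
    · rw [if_pos ⟨le_rfl, p.2⟩]
      exact hlam _
  have hx1 : ∀ p, Real.exp (-Λ p) < 1 := fun p => by simpa using hΛpos p
  have : Fintype (Picture (weightOfHeight η)) := Fintype.ofFinite _
  have hweight : ∀ P : Picture (weightOfHeight η),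
      ∏ p, Real.exp (-Λ p) ^ P.mult p = Real.exp (-∑ k, lam k * η k) := fun P => by
    simp_rw [← Real.exp_nat_mul]
    rw [← Real.exp_sum]
    congr 1
    simp_rw [← P.coverage_mult, coverage, hΛ, Nat.cast_sum, mul_neg, Finset.mul_sum]
    rw [Finset.sum_neg_distrib, Finset.sum_comm]
    congr 1
    refine Finset.sum_congr rfl fun k _ => Finset.sum_congr rfl fun p _ => ?_
    split_ifs
    · ring
    · simp
  have hle : ∀ (P : Picture (weightOfHeight η)) (p : Loop n), P.mult p ≤ η p.1.1 := fun P p => by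
    rw [← P.coverage_mult, coverage]
    refine le_trans (by rw [if_pos ⟨le_rfl, p.2⟩]) (Finset.single_le_sum
      (f := fun q : Loop n => if q.1.1 ≤ p.1.1 ∧ p.1.1 ≤ q.1.2 then P.mult q else 0)
      (fun _ _ => Nat.zero_le _) (Finset.mem_univ p))
  have hmain : (partitionFunction (weightOfHeight η) : ℝ) * Real.exp (-∑ k, lam k * η k)
      ≤ ∏ p, (1 - Real.exp (-Λ p))⁻¹ := by
    calc (partitionFunction (weightOfHeight η) : ℝ) * Real.exp (-∑ k, lam k * η k)
        = ∑ P : Picture (weightOfHeight η), ∏ p, Real.exp (-Λ p) ^ P.mult p := by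
          rw [Finset.sum_congr rfl fun P _ => hweight P, Finset.sum_const, nsmul_eq_mul,
            partitionFunction, Nat.card_eq_fintype_card, Finset.card_univ]
      _ = ∑ c ∈ Finset.univ.image (Picture.mult (ν := weightOfHeight η)),
            ∏ p, Real.exp (-Λ p) ^ c p := by
          rw [Finset.sum_image]
          exact fun P _ Q _ h => Picture.ext h
      _ ≤ ∑ c ∈ Fintype.piFinset fun p : Loop n => Finset.range (η p.1.1 + 1),
            ∏ p, Real.exp (-Λ p) ^ c p := by
          refine Finset.sum_le_sum_of_subset_of_nonneg ?_ fun c _ _ => by positivity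
          intro c hc
          obtain ⟨P, -, rfl⟩ := Finset.mem_image.1 hc
          exact Fintype.mem_piFinset.2 fun p =>
            Finset.mem_range.2 (Nat.lt_succ_of_le (hle P p))
      _ = ∏ p : Loop n, ∑ c ∈ Finset.range (η p.1.1 + 1), Real.exp (-Λ p) ^ c :=
          (Finset.prod_univ_sum _ _).symm
      _ ≤ ∏ p, (1 - Real.exp (-Λ p))⁻¹ := by
          refine Finset.prod_le_prod (fun p _ => Finset.sum_nonneg fun _ _ => by positivity)
            fun p _ => ?_
          rw [← tsum_geometric_of_lt_one (Real.exp_pos _).le (hx1 p)]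
          exact (summable_geometric_of_lt_one (Real.exp_pos _).le (hx1 p)).sum_le_tsum _
            fun _ _ => by positivity
  have hK : (0 : ℝ) < partitionFunction (weightOfHeight η) := by
    exact_mod_cast partitionFunction_pos η
  have hlog := Real.log_le_log (by positivity) hmain
  rw [Real.log_mul hK.ne' (Real.exp_pos _).ne', Real.log_exp,
    Real.log_prod fun p _ => inv_ne_zero (by linarith [hx1 p])] at hlog
  simp_rw [Real.log_inv] at hlog
  rw [logCount]
  linarith

/-- The constant `γ₊ = 2 √ζ(2) = π √(2/3)`. -/
noncomputable def gammaPlus : ℝ := 2 * √(Real.pi ^ 2 / 6)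

theorem gammaPlus_pos : 0 < gammaPlus := by
  rw [gammaPlus]
  positivity

/-- The upper bound holds for every non-decreasing positive height, without an error term: with
`lam k = √ζ(2) / √(η k)`, a loop of length `l` that ends at the vertex `j` has
`∑ k ∈ p, lam k ≥ l * lam j`. -/
theorem logCount_le_gammaPlus_mul {n : ℕ} (η : Fin n → ℕ) (hη : Monotone η) (hpos : ∀ i, 0 < η i) :
    logCount η ≤ gammaPlus * ∑ i, √(η i : ℝ) := by
  set σ : ℝ := √(Real.pi ^ 2 / 6) with hσ
  have hσpos : 0 < σ := by positivity
  have hσ2 : Real.pi ^ 2 / 6 = σ * σ := (Real.mul_self_sqrt (by positivity)).symm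
  have hsq : ∀ i, 0 < √(η i : ℝ) := fun i => Real.sqrt_pos.2 (by exact_mod_cast hpos i)
  have hlam : ∀ i, 0 < σ / √(η i : ℝ) := fun i => div_pos hσpos (hsq i)
  have h1 := logCount_le η (fun i => σ / √(η i : ℝ)) hlam
  have h2 : ∑ k, σ / √(η k : ℝ) * η k = σ * ∑ i, √(η i : ℝ) := by
    rw [Finset.mul_sum]
    refine Finset.sum_congr rfl fun k _ => ?_
    nth_rewrite 2 [← Real.mul_self_sqrt (Nat.cast_nonneg (η k))]
    have := hsq k
    field_simp
  have h3 : ∑ p : Loop n, -Real.log (1 - Real.exp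
      (-∑ k, if p.1.1 ≤ k ∧ k ≤ p.1.2 then σ / √(η k : ℝ) else 0)) ≤ σ * ∑ i, √(η i : ℝ) := by
    calc _ ≤ ∑ p : Loop n, -Real.log (1 - Real.exp
            (-((((p.1.2 - p.1.1 : ℕ) : ℝ) + 1) * (σ / √(η p.1.2 : ℝ))))) := by
          refine Finset.sum_le_sum fun p _ => ?_
          have hl : 0 < (((p.1.2 - p.1.1 : ℕ) : ℝ) + 1) * (σ / √(η p.1.2 : ℝ)) :=
            mul_pos (by positivity) (hlam _)
          refine neg_le_neg (Real.log_le_log (by simpa using hl) ?_)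
          refine sub_le_sub_left (Real.exp_le_exp.2 (neg_le_neg ?_)) _
          rw [← Finset.sum_filter]
          have hcard : (Finset.univ.filter fun k => p.1.1 ≤ k ∧ k ≤ p.1.2).card
              = p.1.2 - p.1.1 + 1 := by
            have : (Finset.univ.filter fun k => p.1.1 ≤ k ∧ k ≤ p.1.2)
                = Finset.Icc p.1.1 p.1.2 := by
              ext
              simp
            rw [this, Fin.card_Icc]
            have := Fin.le_def.1 p.2
            omega
          have := Finset.card_nsmul_le_sum (Finset.univ.filter fun k => p.1.1 ≤ k ∧ k ≤ p.1.2)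
            (fun k => σ / √(η k : ℝ)) (σ / √(η p.1.2 : ℝ)) fun k hk => by
              refine div_le_div_of_nonneg_left hσpos.le (hsq k) (Real.sqrt_le_sqrt ?_)
              exact_mod_cast hη (Finset.mem_filter.1 hk).2.2
          rw [hcard, nsmul_eq_mul] at this
          exact_mod_cast this
      _ = ∑ j : Fin n, ∑ l ∈ Finset.range (j + 1), -Real.log (1 - Real.exp
            (-(((l : ℝ) + 1) * (σ / √(η j : ℝ))))) := by
          rw [Finset.sum_sigma']
          refine Finset.sum_bij' (fun p _ => ⟨p.1.2, p.1.2 - p.1.1⟩)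
            (fun q hq => ⟨(⟨q.1 - q.2, by omega⟩, q.1), by
              rw [Fin.le_def]
              exact Nat.sub_le _ _⟩) ?_ ?_ ?_ ?_ ?_
          · intro p _
            simp only [Finset.mem_sigma, Finset.mem_univ, Finset.mem_range, true_and]
            omega
          · simp
          · rintro ⟨⟨a, b⟩, hab⟩ _
            rw [Fin.le_def] at hab
            simp only [Subtype.mk.injEq, Prod.mk.injEq, Fin.ext_iff, and_true]
            dsimp only at hab
            omega
          · rintro ⟨j, l⟩ hq
            simp only [Finset.mem_sigma, Finset.mem_univ, Finset.mem_range, true_and] at hq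
            simp only [Sigma.mk.injEq, heq_eq_eq, true_and]
            omega
          · intro p _
            rfl
      _ ≤ ∑ j, σ * √(η j : ℝ) := by
          refine Finset.sum_le_sum fun j _ => ?_
          refine (sum_neg_log_one_sub_exp_neg_le (hlam j) _).trans_eq ?_
          have := hsq j
          rw [hσ2]
          field_simp
      _ = _ := (Finset.mul_sum _ _ _).symm
  rw [gammaPlus, ← hσ]
  linarith

/-! ### Binomial coefficients and Riemann sums -/

theorem le_log_factorial (n : ℕ) : n * Real.log n - n ≤ Real.log (n ! : ℕ) := by
  rcases Nat.eq_zero_or_pos n with rfl | hn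
  · simp
  have hn' : (0 : ℝ) < n := by exact_mod_cast hn
  have hf : (0 : ℝ) < (n ! : ℕ) := by exact_mod_cast n.factorial_pos
  have h := Real.pow_div_factorial_le_exp (n : ℝ) hn'.le n
  have h2 := Real.log_le_log (by positivity) h
  rw [Real.log_exp, Real.log_div (by positivity) hf.ne', Real.log_pow] at h2
  linarith

theorem log_factorial_le (n : ℕ) :
    Real.log (n ! : ℕ) ≤ (n + 1) * Real.log (n + 1) - n := by
  induction n with
  | zero => simp
  | succ n ih =>
    rw [Nat.factorial_succ, Nat.cast_mul, Real.log_mul (by positivity)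
      (by exact_mod_cast n.factorial_pos.ne')]
    have h := Real.one_sub_inv_le_log_of_pos (x := ((n : ℝ) + 2) / (n + 1)) (by positivity)
    rw [Real.log_div (by positivity) (by positivity), inv_div] at h
    have h2 : (1 - ((n : ℝ) + 1) / (n + 2)) * (n + 2) = 1 := by
      field_simp
      ring
    have h3 := mul_le_mul_of_nonneg_right h (by positivity : (0 : ℝ) ≤ (n : ℝ) + 2)
    push_cast
    rw [show (n : ℝ) + 1 + 1 = n + 2 by ring]
    linarith

/-- Stirling's formula to first order, in a form in which the terms `a n * log (N n)` and `a n`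
cancel in a binomial coefficient. -/
theorem tendsto_log_factorial {a : ℕ → ℕ} {N : ℕ → ℝ} {c : ℝ} (hN : Tendsto N atTop atTop)
    (ha : Tendsto (fun n => a n / N n) atTop (𝓝 c)) :
    Tendsto (fun n => (Real.log ((a n)! : ℕ) - a n * Real.log (N n) + a n) / N n) atTop
      (𝓝 (c * Real.log c)) := by
  have hN0 : ∀ᶠ n in atTop, 0 < N n := hN.eventually_gt_atTop 0
  have hinv : Tendsto (fun n => (N n)⁻¹) atTop (𝓝 0) := tendsto_inv_atTop_zero.comp hN
  have hlogN : Tendsto (fun n => Real.log (N n) / N n) atTop (𝓝 0) :=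
    (Real.isLittleO_log_id_atTop.tendsto_div_nhds_zero).comp hN
  have h1 : Tendsto (fun n => (a n / N n) * Real.log (a n / N n)) atTop (𝓝 (c * Real.log c)) :=
    (Real.continuous_mul_log.tendsto c).comp ha
  have ha' : Tendsto (fun n => a n / N n + (N n)⁻¹) atTop (𝓝 c) := by
    simpa using ha.add hinv
  have h2 : Tendsto (fun n => (a n / N n + (N n)⁻¹) * Real.log (a n / N n + (N n)⁻¹)
      + Real.log (N n) / N n) atTop (𝓝 (c * Real.log c)) := by
    simpa using ((Real.continuous_mul_log.tendsto c).comp ha').add hlogN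
  refine tendsto_of_tendsto_of_tendsto_of_le_of_le' h1 h2 ?_ ?_
  · filter_upwards [hN0] with n hn
    rcases Nat.eq_zero_or_pos (a n) with h0 | h0
    · simp [h0]
    have h0' : (0 : ℝ) < a n := by exact_mod_cast h0
    rw [Real.log_div h0'.ne' hn.ne', div_mul_eq_mul_div]
    refine div_le_div_of_nonneg_right ?_ hn.le
    have := le_log_factorial (a n)
    linarith
  · filter_upwards [hN0] with n hn
    have h0' : (0 : ℝ) < (a n : ℝ) + 1 := by positivity
    rw [inv_eq_one_div, ← add_div, Real.log_div h0'.ne' hn.ne', div_mul_eq_mul_div, ← add_div]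
    refine div_le_div_of_nonneg_right ?_ hn.le
    have := log_factorial_le (a n)
    linarith

theorem tendsto_log_multichoose {c : ℝ} (hc : 0 ≤ c) :
    Tendsto (fun s : ℕ => Real.log ((s * s).multichoose ⌊(s : ℝ) * s * c⌋₊) / ((s : ℝ) * s)) atTop
      (𝓝 ((1 + c) * Real.log (1 + c) - c * Real.log c)) := by
  have hN : Tendsto (fun s : ℕ => (s : ℝ) * s) atTop atTop :=
    tendsto_natCast_atTop_atTop.atTop_mul_atTop₀ tendsto_natCast_atTop_atTop
  have hinv : Tendsto (fun s : ℕ => ((s : ℝ) * s)⁻¹) atTop (𝓝 0) := tendsto_inv_atTop_zero.comp hN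
  have hn : Tendsto (fun s : ℕ => (⌊(s : ℝ) * s * c⌋₊ : ℝ) / ((s : ℝ) * s)) atTop (𝓝 c) := by
    have := (tendsto_nat_floor_mul_div_atTop hc).comp hN
    refine this.congr fun s => ?_
    simp [mul_comm c]
  have hs1 : ∀ᶠ s : ℕ in atTop, 1 ≤ s * s := by
    filter_upwards [eventually_ge_atTop 1] with s hs using Nat.mul_pos hs hs
  have hone : Tendsto (fun s : ℕ => ((s * s - 1 : ℕ) : ℝ) / ((s : ℝ) * s)) atTop (𝓝 1) := by
    have : Tendsto (fun s : ℕ => 1 - ((s : ℝ) * s)⁻¹) atTop (𝓝 1) := by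
      simpa using tendsto_const_nhds.sub hinv
    refine this.congr' ?_
    filter_upwards [hs1] with s hs
    have : (s : ℝ) * s ≠ 0 := by exact_mod_cast (by omega : s * s ≠ 0)
    rw [Nat.cast_sub hs]
    push_cast
    rw [sub_div, div_self this, one_div]
  have hsum : Tendsto (fun s : ℕ => ((s * s - 1 + ⌊(s : ℝ) * s * c⌋₊ : ℕ) : ℝ) / ((s : ℝ) * s))
      atTop (𝓝 (1 + c)) := by
    refine (hone.add hn).congr fun s => ?_
    push_cast
    ring
  have hf : ∀ k : ℕ, ((k ! : ℕ) : ℝ) ≠ 0 := fun k => by exact_mod_cast k.factorial_pos.ne'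
  have h := ((tendsto_log_factorial hN hsum).sub (tendsto_log_factorial hN hone)).sub
    (tendsto_log_factorial hN hn)
  rw [Real.log_one, mul_zero, sub_zero] at h
  refine h.congr' ?_
  filter_upwards [hs1] with s hs
  rw [Nat.multichoose_eq, show s * s + ⌊(s : ℝ) * s * c⌋₊ - 1 = s * s - 1 + ⌊(s : ℝ) * s * c⌋₊ by omega,
    ← Nat.choose_symm_add, Nat.cast_add_choose, Real.log_div (hf _) (mul_ne_zero (hf _) (hf _)),
    Real.log_mul (hf _) (hf _)]
  push_cast
  ring

/-- The entropy of a geometric random variable with mean `1 / (exp x - 1)`. -/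
noncomputable def entropy (x : ℝ) : ℝ :=
  -Real.log (1 - Real.exp (-x)) + x * (1 / (Real.exp x - 1))

theorem entropy_eq {x : ℝ} (hx : 0 < x) :
    (1 + 1 / (Real.exp x - 1)) * Real.log (1 + 1 / (Real.exp x - 1))
      - 1 / (Real.exp x - 1) * Real.log (1 / (Real.exp x - 1)) = entropy x := by
  have h1 : 0 < Real.exp x - 1 := by simpa using hx
  have h2 : 1 - Real.exp (-x) = (Real.exp x - 1) / Real.exp x := by
    rw [Real.exp_neg]
    field_simp
  have h3 : 1 + 1 / (Real.exp x - 1) = Real.exp x / (Real.exp x - 1) := by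
    field_simp
    ring
  rw [entropy, h2, h3, Real.log_div (by positivity) h1.ne', Real.log_div h1.ne' (by positivity),
    Real.log_div one_ne_zero h1.ne', Real.log_exp, Real.log_one]
  field_simp
  ring

theorem hasSum_one_div_exp_sub_one {x : ℝ} (hx : 0 < x) :
    HasSum (fun k : ℕ => Real.exp (-(((k : ℝ) + 1) * x))) (1 / (Real.exp x - 1)) := by
  have h1 : Real.exp (-x) < 1 := by simpa using hx
  have h2 : 0 < Real.exp x - 1 := by simpa using hx
  have h := (hasSum_geometric_of_lt_one (Real.exp_pos _).le h1).mul_left (Real.exp (-x))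
  have h3 : 1 - Real.exp (-x) = (Real.exp x - 1) / Real.exp x := by
    rw [Real.exp_neg]
    field_simp
  have h4 : 1 / (Real.exp x - 1) = Real.exp (-x) * (1 - Real.exp (-x))⁻¹ := by
    rw [h3, Real.exp_neg]
    field_simp
  have h5 : ∀ k : ℕ, Real.exp (-(((k : ℝ) + 1) * x)) = Real.exp (-x) * Real.exp (-x) ^ k := by
    intro k
    rw [← Real.exp_nat_mul, ← Real.exp_add]
    ring_nf
  simpa only [h4, h5] using h

theorem entropy_nonneg {x : ℝ} (hx : 0 < x) : 0 ≤ entropy x := by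
  have h2 : 0 < Real.exp x - 1 := by simpa using hx
  exact add_nonneg ((hasSum_neg_log_one_sub_exp_neg hx).nonneg fun _ => by positivity)
    (by positivity)

theorem sum_le_entropy {x : ℝ} (hx : 0 < x) (K : ℕ) :
    ∑ k ∈ Finset.range K, Real.exp (-(((k : ℝ) + 1) * x)) * (1 / ((k : ℝ) + 1) + x)
      ≤ entropy x := by
  have h := (hasSum_neg_log_one_sub_exp_neg hx).add ((hasSum_one_div_exp_sub_one hx).mul_left x)
  refine le_trans (le_of_eq ?_) (sum_le_hasSum (Finset.range K) (fun _ _ => by positivity) h)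
  exact Finset.sum_congr rfl fun _ _ => by ring

/-- A primitive of `-exp (-k y) * (1 / k + y)`. -/
noncomputable def primitive (k y : ℝ) : ℝ :=
  Real.exp (-(k * y)) * (2 / k ^ 2 + y / k)

theorem two_sub_le_mul_exp_neg {u : ℝ} (hu : 0 ≤ u) : 2 - u ≤ (2 + u) * Real.exp (-u) := by
  have hd : ∀ x : ℝ, HasDerivAt (fun u : ℝ => u + (2 + u) * Real.exp (-u))
      (1 - (1 + x) * Real.exp (-x)) x := by
    intro x
    have h1 := (hasDerivAt_neg x).exp
    have h2 := ((hasDerivAt_id' x).const_add 2).mul h1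
    refine ((hasDerivAt_id' x).add h2).congr_deriv ?_
    ring
  have hmono : Monotone fun u : ℝ => u + (2 + u) * Real.exp (-u) := by
    refine monotone_of_deriv_nonneg (fun x => (hd x).differentiableAt) fun x => ?_
    rw [(hd x).deriv]
    have h2 : (x + 1) * Real.exp (-x) ≤ Real.exp x * Real.exp (-x) :=
      mul_le_mul_of_nonneg_right (Real.add_one_le_exp x) (Real.exp_pos _).le
    rw [← Real.exp_add, add_neg_cancel, Real.exp_zero] at h2
    linarith
  have := hmono hu
  simp only [zero_add, add_zero, neg_zero, Real.exp_zero, mul_one] at this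
  linarith

/-- Comparison of a step of a Riemann sum of a decreasing function with its integral. -/
theorem primitive_sub_le {k y t : ℝ} (hk : 0 < k) (hy : 0 ≤ y) (ht : 0 ≤ t) :
    primitive k y - primitive k (y + t) ≤ t * (Real.exp (-(k * y)) * (1 / k + y)) := by
  have h1 := two_sub_le_mul_exp_neg (mul_nonneg hk.le ht)
  have h2 := Real.add_one_le_exp (-(k * t))
  have h3 : Real.exp (-(k * (y + t))) = Real.exp (-(k * y)) * Real.exp (-(k * t)) := by
    rw [← Real.exp_add]
    ring_nf
  rw [primitive, primitive, h3]
  have h4 : 0 ≤ k * t * (1 + k * y) - (2 + k * y)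
      + Real.exp (-(k * t)) * (2 + k * y + k * t) := by
    have := mul_nonneg (mul_nonneg hk.le hy) (by linarith :
      0 ≤ k * t - 1 + Real.exp (-(k * t)))
    nlinarith
  have h5 := mul_nonneg (Real.exp_pos (-(k * y))).le h4
  have h6 : t * (Real.exp (-(k * y)) * (1 / k + y)) - (Real.exp (-(k * y)) * (2 / k ^ 2 + y / k)
      - Real.exp (-(k * y)) * Real.exp (-(k * t)) * (2 / k ^ 2 + (y + t) / k))
      = Real.exp (-(k * y)) * (k * t * (1 + k * y) - (2 + k * y)
      + Real.exp (-(k * t)) * (2 + k * y + k * t)) / k ^ 2 := by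
    field_simp
    ring
  have h7 := div_nonneg h5 (sq_nonneg k)
  linarith

theorem tendsto_primitive_zero {k : ℝ} :
    Tendsto (primitive k) (𝓝 0) (𝓝 (2 / k ^ 2)) := by
  have : Continuous (primitive k) := by
    unfold primitive
    fun_prop
  simpa [primitive] using this.tendsto 0

theorem tendsto_primitive_atTop {k : ℝ} (hk : 0 < k) :
    Tendsto (primitive k) atTop (𝓝 0) := by
  have hky : Tendsto (fun y : ℝ => k * y) atTop atTop := tendsto_id.const_mul_atTop hk
  have h0 := (Real.tendsto_pow_mul_exp_neg_atTop_nhds_zero 0).comp hky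
  have h1 := (Real.tendsto_pow_mul_exp_neg_atTop_nhds_zero 1).comp hky
  have := (h0.mul_const (2 / k ^ 2)).add (h1.mul_const (1 / k ^ 2))
  simp only [zero_mul, add_zero] at this
  refine this.congr fun y => ?_
  simp only [Function.comp, primitive, pow_zero, pow_one]
  field_simp

/-- The Riemann sums of the entropy come close to `∫ entropy = 2 ζ(2)`, also with the weights
`M - m` that count the pairs of cells at distance `m`. -/
theorem exists_entropy_sum_ge {ε : ℝ} (hε : 0 < ε) :
    ∃ τ : ℝ, 0 < τ ∧ ∃ M : ℕ, 0 < M ∧ M * (Real.pi ^ 2 / 3 - ε)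
      ≤ τ * ∑ m ∈ Finset.Ico 1 M, ((M : ℝ) - m) * entropy (((m : ℝ) + 1) * τ) := by
  have hK : ∀ᶠ K : ℕ in atTop, Real.pi ^ 2 / 3 - ε
      < ∑ k ∈ Finset.range K, 2 / ((k : ℝ) + 1) ^ 2 := by
    have := (hasSum_one_div_succ_sq.mul_left 2).tendsto_sum_nat
    refine (this.eventually (lt_mem_nhds (a := Real.pi ^ 2 / 3 - ε) (by linarith))).mono
      fun K h => h.trans_eq (Finset.sum_congr rfl fun k _ => by ring)
  obtain ⟨K, hK⟩ := hK.exists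
  have hτ : Tendsto (fun τ : ℝ => ∑ k ∈ Finset.range K, primitive ((k : ℝ) + 1) (2 * τ))
      (𝓝[>] 0) (𝓝 (∑ k ∈ Finset.range K, 2 / ((k : ℝ) + 1) ^ 2)) := by
    refine tendsto_finsetSum _ fun k _ => tendsto_primitive_zero.comp ?_
    have : Tendsto (fun τ : ℝ => 2 * τ) (𝓝 0) (𝓝 (2 * 0)) :=
      (continuous_const.mul continuous_id).tendsto 0
    rw [mul_zero] at this
    exact this.mono_left nhdsWithin_le_nhds
  obtain ⟨τ, hτ1, hτpos⟩ :=
    ((hτ.eventually (lt_mem_nhds hK)).and self_mem_nhdsWithin).exists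
  replace hτpos : 0 < τ := hτpos
  have hP : Tendsto (fun P : ℕ => ∑ k ∈ Finset.range K, (primitive ((k : ℝ) + 1) (2 * τ)
      - primitive ((k : ℝ) + 1) (((P : ℝ) + 2) * τ))) atTop
      (𝓝 (∑ k ∈ Finset.range K, (primitive ((k : ℝ) + 1) (2 * τ) - 0))) := by
    refine tendsto_finsetSum _ fun k _ => tendsto_const_nhds.sub
      ((tendsto_primitive_atTop (by positivity)).comp ?_)
    exact (tendsto_atTop_add_const_right _ _ tendsto_natCast_atTop_atTop).atTop_mul_const hτpos
  simp only [sub_zero] at hP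
  obtain ⟨P, hP⟩ := (hP.eventually (lt_mem_nhds hτ1)).exists
  set T := τ * ∑ i ∈ Finset.range P, entropy (((i : ℝ) + 2) * τ) with hT
  have hPT : ∑ k ∈ Finset.range K, (primitive ((k : ℝ) + 1) (2 * τ)
      - primitive ((k : ℝ) + 1) (((P : ℝ) + 2) * τ)) ≤ T := by
    have htel : ∀ k : ℕ, primitive ((k : ℝ) + 1) (2 * τ)
        - primitive ((k : ℝ) + 1) (((P : ℝ) + 2) * τ)
        = ∑ i ∈ Finset.range P, (primitive ((k : ℝ) + 1) (((i : ℝ) + 2) * τ)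
          - primitive ((k : ℝ) + 1) (((i : ℝ) + 2) * τ + τ)) := by
      intro k
      have := Finset.sum_range_sub' (fun i : ℕ => primitive ((k : ℝ) + 1) (((i : ℝ) + 2) * τ)) P
      rw [Nat.cast_zero, zero_add] at this
      rw [← this]
      refine Finset.sum_congr rfl fun i _ => ?_
      push_cast
      ring_nf
    simp_rw [htel]
    rw [Finset.sum_comm, hT, Finset.mul_sum]
    refine Finset.sum_le_sum fun i _ => ?_
    have hi : 0 < ((i : ℝ) + 2) * τ := by positivity
    refine le_trans ?_ (mul_le_mul_of_nonneg_left (sum_le_entropy hi K) hτpos.le)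
    rw [Finset.mul_sum]
    exact Finset.sum_le_sum fun k _ => primitive_sub_le (by positivity) hi.le hτpos.le
  have hTlt : Real.pi ^ 2 / 3 - ε < T := hP.trans_le hPT
  -- Only distances `m ≤ P` are used, with weight at least `M - P`; this `M` makes
  -- `(M - P) * T ≥ M * (π ^ 2 / 3 - ε)`.
  obtain ⟨M, hM⟩ := exists_nat_ge (P * T / (T - (Real.pi ^ 2 / 3 - ε)) + P + 1)
  have hT0 : 0 ≤ T := mul_nonneg hτpos.le (Finset.sum_nonneg fun i _ =>
    entropy_nonneg (by positivity))
  have hdiv : 0 ≤ P * T / (T - (Real.pi ^ 2 / 3 - ε)) :=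
    div_nonneg (by positivity) (by linarith)
  have hPM : P + 1 ≤ M := by
    have : (P : ℝ) + 1 ≤ M := by linarith
    exact_mod_cast this
  refine ⟨τ, hτpos, M, by omega, ?_⟩
  have h1 : M * (Real.pi ^ 2 / 3 - ε) ≤ (M - P) * T := by
    have : P * T / (T - (Real.pi ^ 2 / 3 - ε)) ≤ M := by
      have : (0 : ℝ) ≤ P := by positivity
      linarith
    rw [div_le_iff₀ (by linarith)] at this
    linarith
  refine h1.trans ?_
  rw [hT, mul_left_comm]
  refine mul_le_mul_of_nonneg_left ?_ hτpos.le
  rw [Finset.mul_sum]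
  calc ∑ i ∈ Finset.range P, ((M : ℝ) - P) * entropy (((i : ℝ) + 2) * τ)
      ≤ ∑ i ∈ Finset.range P, ((M : ℝ) - (1 + i : ℕ)) * entropy ((((1 + i : ℕ) : ℝ) + 1) * τ) := by
        refine Finset.sum_le_sum fun i hi => ?_
        have hi' : (i : ℝ) + 1 ≤ P := by exact_mod_cast Finset.mem_range.1 hi
        push_cast
        rw [show (1 : ℝ) + i + 1 = i + 2 by ring]
        refine mul_le_mul_of_nonneg_right (by linarith) (entropy_nonneg (by positivity))
    _ = ∑ m ∈ Finset.Ico 1 (P + 1), ((M : ℝ) - m) * entropy (((m : ℝ) + 1) * τ) := by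
        rw [Finset.sum_Ico_eq_sum_range, Nat.add_sub_cancel]
    _ ≤ _ := by
        refine Finset.sum_le_sum_of_subset_of_nonneg (Finset.Ico_subset_Ico_right hPM)
          fun m hm _ => mul_nonneg ?_ (entropy_nonneg (by positivity))
        rw [sub_nonneg]
        exact_mod_cast (Finset.mem_Ico.1 hm).2.le

theorem sum_mul_exp_neg_le {u : ℝ} (hu : 0 < u) (n : ℕ) :
    ∑ l ∈ Finset.range n, ((l : ℝ) + 1) * Real.exp (-(((l : ℝ) + 1) * u)) ≤ 1 / u ^ 2 := by
  have hq : Real.exp (-u) < 1 := by simpa using hu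
  have h := (hasSum_nat_add_iff' 1).2 (hasSum_coe_mul_geometric_of_norm_lt_one
    (r := Real.exp (-u)) (by rwa [Real.norm_of_nonneg (Real.exp_pos _).le]))
  simp only [Finset.range_one, Finset.sum_singleton, Nat.cast_zero, zero_mul, sub_zero] at h
  have hle := sum_le_hasSum (Finset.range n) (fun _ _ => by positivity) h
  refine le_trans (le_of_eq (Finset.sum_congr rfl fun l _ => ?_)) (hle.trans ?_)
  · rw [← Real.exp_nat_mul]
    push_cast
    ring_nf
  · have h1 : (1 - Real.exp (-u)) ≠ 0 := by linarith
    rw [div_le_div_iff₀ (by positivity) (by positivity), one_mul]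
    have h2 : u / 2 ≤ Real.sinh (u / 2) := Real.self_le_sinh_iff.2 (by positivity)
    rw [Real.sinh_eq] at h2
    have hr := Real.exp_pos (-(u / 2))
    have hrr : Real.exp (-u) = Real.exp (-(u / 2)) * Real.exp (-(u / 2)) := by
      rw [← Real.exp_add]
      ring_nf
    have hr1 : Real.exp (u / 2) * Real.exp (-(u / 2)) = 1 := by
      rw [← Real.exp_add, add_neg_cancel, Real.exp_zero]
    have h3 : u * Real.exp (-(u / 2)) ≤ 1 - Real.exp (-u) := by
      rw [hrr]
      nlinarith
    calc Real.exp (-u) * u ^ 2 = (u * Real.exp (-(u / 2))) ^ 2 := by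
          rw [hrr]
          ring
      _ ≤ _ := pow_le_pow_left₀ (by positivity) h3 2

/-- The coverage of the optimal family of loops: a Riemann sum for `∫ t / (exp t - 1) = ζ(2)`. -/
theorem sum_mul_one_div_exp_sub_one_le {τ : ℝ} (hτ : 0 < τ) (n : ℕ) :
    ∑ l ∈ Finset.range n, ((l : ℝ) + 1) * (1 / (Real.exp (((l : ℝ) + 1) * τ) - 1))
      ≤ Real.pi ^ 2 / 6 / τ ^ 2 := by
  have h1 := hasSum_sum (s := Finset.range n) fun l _ =>
    (hasSum_one_div_exp_sub_one (x := ((l : ℝ) + 1) * τ) (by positivity)).mul_left ((l : ℝ) + 1)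
  refine hasSum_le (fun k => ?_) h1 (hasSum_one_div_succ_sq.div_const _)
  have h2 := sum_mul_exp_neg_le (u := ((k : ℝ) + 1) * τ) (by positivity) n
  calc _ = ∑ l ∈ Finset.range n, ((l : ℝ) + 1) * Real.exp (-(((l : ℝ) + 1) * (((k : ℝ) + 1) * τ))) :=
        Finset.sum_congr rfl fun l _ => by ring_nf
    _ ≤ _ := h2
    _ = _ := by field_simp

/-! ### The lower bound -/

/-- On a suitable number `W` of vertices, of the order of `√h`, the pictures of height at least `h`
have almost the full entropy. -/
theorem exists_block {ε : ℝ} (hε : 0 < ε) (hεσ : ε < gammaPlus / 2) :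
    ∃ B : ℝ, 0 ≤ B ∧ ∃ H : ℕ, ∀ h : ℕ, H ≤ h → ∃ W : ℕ, 0 < W ∧ W ≤ B * √(h : ℝ) ∧
      ∀ η : Fin W → ℕ, (∀ i, h ≤ η i) → (gammaPlus - ε) * (W * √(h : ℝ)) ≤ logCount η := by
  set σ : ℝ := √(Real.pi ^ 2 / 6) with hσ
  have hγ : gammaPlus = 2 * σ := rfl
  have hσpos : 0 < σ := by positivity
  have hσ2 : Real.pi ^ 2 / 6 = σ * σ := (Real.mul_self_sqrt (by positivity)).symm
  have hε' : 0 < ε * σ / 4 := by positivity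
  obtain ⟨τ, hτ, M, hM, hent⟩ := exists_entropy_sum_ge hε'
  have hM' : (0 : ℝ) < M := by exact_mod_cast hM
  -- The mean multiplicity of a loop between cells at distance `m`; `m + 1` in place of `m` bounds the
  -- length of such a loop from above, so that the coverage does not exceed `h`.
  let c : ℕ → ℝ := fun m => 1 / (Real.exp (((m : ℝ) + 1) * τ) - 1)
  have hc : ∀ m, 0 ≤ c m := fun m => by
    have : 0 < Real.exp (((m : ℝ) + 1) * τ) - 1 := by
      rw [sub_pos, Real.one_lt_exp_iff]
      positivity
    positivity
  let N : ℕ → ℕ → ℕ := fun s m => ⌊(s : ℝ) * s * c m⌋₊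
  have hlim : Tendsto (fun s : ℕ => ∑ m ∈ Finset.Ico 1 M, ((M : ℝ) - m) *
      (Real.log ((s * s).multichoose (N s m)) / ((s : ℝ) * s))) atTop
      (𝓝 (∑ m ∈ Finset.Ico 1 M, ((M : ℝ) - m) * entropy (((m : ℝ) + 1) * τ))) := by
    refine tendsto_finsetSum _ fun m _ => Tendsto.const_mul _ ?_
    have := tendsto_log_multichoose (hc m)
    rwa [entropy_eq (by positivity)] at this
  have hlt : M * (Real.pi ^ 2 / 3 - 2 * (ε * σ / 4)) / τ
      < ∑ m ∈ Finset.Ico 1 M, ((M : ℝ) - m) * entropy (((m : ℝ) + 1) * τ) := by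
    rw [div_lt_iff₀ hτ, mul_comm _ τ]
    refine lt_of_lt_of_le ?_ hent
    exact mul_lt_mul_of_pos_left (by linarith) hM'
  obtain ⟨s₀, hs₀⟩ := eventually_atTop.1 (hlim.eventually (lt_mem_nhds hlt))
  have hsqrt : Tendsto (fun h : ℕ => √(h : ℝ)) atTop atTop :=
    Real.tendsto_sqrt_atTop.comp tendsto_natCast_atTop_atTop
  obtain ⟨H, hH⟩ := eventually_atTop.1 (hsqrt.eventually_ge_atTop
    (max ((s₀ + 1) * σ / τ) ((Real.pi ^ 2 / 3 - 2 * (ε * σ / 4)) / τ / (ε / 2))))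
  refine ⟨M * (τ / σ), by positivity, H, fun h hh => ?_⟩
  have h1 := (le_max_left _ _).trans (hH h hh)
  have h2 := (le_max_right _ _).trans (hH h hh)
  rw [div_le_iff₀ hτ] at h1
  rw [div_le_iff₀ (by positivity)] at h2
  set r : ℝ := √(h : ℝ) with hr
  have hrr : r * r = h := Real.mul_self_sqrt (by positivity)
  have hr0 : 0 ≤ r := Real.sqrt_nonneg _
  -- The largest cell size for which the coverage bound `s ^ 2 * ζ(2) / τ ^ 2` is at most `h`.
  obtain ⟨s, hs⟩ : ∃ s : ℕ, s = ⌊τ * r / σ⌋₊ := ⟨_, rfl⟩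
  have hs_le : (s : ℝ) ≤ τ * r / σ := hs ▸ Nat.floor_le (by positivity)
  have hs_gt : τ * r / σ < s + 1 := hs ▸ Nat.lt_floor_add_one _
  have hs1 : s₀ + 1 ≤ s := by
    rw [hs]
    refine Nat.le_floor ?_
    rw [le_div_iff₀ hσpos]
    push_cast
    linarith
  have hspos : (0 : ℝ) < s := by exact_mod_cast (by omega : 0 < s)
  have hcov : ∑ m ∈ Finset.Ico 1 M, (m + 1) * N s m ≤ h := by
    have hreal : ∑ m ∈ Finset.Ico 1 M, ((m : ℝ) + 1) * (N s m : ℝ) ≤ h := by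
      calc ∑ m ∈ Finset.Ico 1 M, ((m : ℝ) + 1) * (N s m : ℝ)
          ≤ ∑ m ∈ Finset.Ico 1 M, ((m : ℝ) + 1) * ((s : ℝ) * s * c m) :=
            Finset.sum_le_sum fun m _ => mul_le_mul_of_nonneg_left
              (Nat.floor_le (mul_nonneg (by positivity) (hc m))) (by positivity)
        _ ≤ ∑ m ∈ Finset.range M, ((m : ℝ) + 1) * ((s : ℝ) * s * c m) := by
            refine Finset.sum_le_sum_of_subset_of_nonneg (fun m hm => ?_) fun m _ _ =>
              mul_nonneg (by positivity) (mul_nonneg (by positivity) (hc m))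
            exact Finset.mem_range.2 (Finset.mem_Ico.1 hm).2
        _ = (s : ℝ) * s * ∑ m ∈ Finset.range M, ((m : ℝ) + 1) * c m := by
            rw [Finset.mul_sum]
            exact Finset.sum_congr rfl fun m _ => by ring
        _ ≤ (s : ℝ) * s * (Real.pi ^ 2 / 6 / τ ^ 2) :=
            mul_le_mul_of_nonneg_left (sum_mul_one_div_exp_sub_one_le hτ M) (by positivity)
        _ ≤ (τ * r / σ) * (τ * r / σ) * (Real.pi ^ 2 / 6 / τ ^ 2) :=
            mul_le_mul_of_nonneg_right
              (mul_le_mul hs_le hs_le hspos.le (by positivity)) (by positivity)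
        _ = h := by
            rw [hσ2, ← hrr]
            field_simp
    exact_mod_cast hreal
  refine ⟨M * s, Nat.mul_pos hM (by omega), ?_, fun η hη => ?_⟩
  · push_cast
    rw [mul_assoc]
    refine mul_le_mul_of_nonneg_left (hs_le.trans_eq (by ring)) hM'.le
  · refine le_trans ?_ (sum_log_multichoose_le_logCount M s h (N s) hcov η hη (by omega))
    have h3 := hs₀ s (by omega)
    simp_rw [← mul_div_assoc] at h3
    rw [← Finset.sum_div, lt_div_iff₀ (by positivity)] at h3
    refine le_trans ?_ h3.le
    have h4 : (gammaPlus - ε) * r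
        ≤ (Real.pi ^ 2 / 3 - 2 * (ε * σ / 4)) / τ * s := by
      have h5 : 0 ≤ (Real.pi ^ 2 / 3 - 2 * (ε * σ / 4)) / τ := by
        refine div_nonneg ?_ hτ.le
        rw [hγ] at hεσ
        nlinarith
      have h6 := mul_le_mul_of_nonneg_left (sub_le_iff_le_add.2 hs_gt.le) h5
      have h7 : (Real.pi ^ 2 / 3 - 2 * (ε * σ / 4)) / τ * (τ * r / σ) = (2 * σ - ε / 2) * r := by
        rw [show Real.pi ^ 2 / 3 = 2 * (σ * σ) by rw [← hσ2]; ring]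
        field_simp
        ring
      rw [mul_sub, h7] at h6
      rw [hγ]
      linarith
    calc (gammaPlus - ε) * (((M * s : ℕ) : ℝ) * r) = M * s * ((gammaPlus - ε) * r) := by
          push_cast
          ring
      _ ≤ M * s * ((Real.pi ^ 2 / 3 - 2 * (ε * σ / 4)) / τ * s) :=
          mul_le_mul_of_nonneg_left h4 (by positivity)
      _ = _ := by ring

/-- Blocks put side by side: the loss of replacing the heights in a block by the first of them is
at most `B * (η W - η 0)`, and these differences telescope. -/
theorem mul_sum_sqrt_le_of_blocks {D B : ℝ} {H : ℕ} (hD : 0 ≤ D) (hB : 0 ≤ B)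
    (hblock : ∀ h : ℕ, H ≤ h → ∃ W : ℕ, 0 < W ∧ W ≤ B * √(h : ℝ) ∧
      ∀ η : Fin W → ℕ, (∀ i, h ≤ η i) → D * (W * √(h : ℝ)) ≤ logCount η)
    (y : ℕ) (n : ℕ) (η : ℕ → ℕ) (hη : Monotone η) (hH : H ≤ η 0) (hy0 : η 0 ≤ y)
    (hy : ∀ i < n, η i ≤ y) :
    D * ∑ i ∈ Finset.range n, √(η i : ℝ)
      ≤ (logCount fun i : Fin n => η i) + D * B * (2 * y - η 0) := by
  induction n using Nat.strong_induction_on generalizing η with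
  | _ n ih =>
  obtain ⟨W, hW, hWB, hWη⟩ := hblock (η 0) hH
  have hy0' : (η 0 : ℝ) ≤ y := by exact_mod_cast hy0
  have hsq : ∀ m : ℕ, √(m : ℝ) * √(m : ℝ) = m := fun m => Real.mul_self_sqrt (by positivity)
  have hmono : ∀ {a b : ℕ}, a ≤ b → √(a : ℝ) ≤ √(b : ℝ) := fun hab =>
    Real.sqrt_le_sqrt (by exact_mod_cast hab)
  -- An incomplete last block has at most `B * √y` vertices of height at most `y`.
  rcases le_or_gt n W with hn | hn
  · have h1 : ∑ i ∈ Finset.range n, √(η i : ℝ) ≤ B * y := by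
      calc ∑ i ∈ Finset.range n, √(η i : ℝ) ≤ ∑ i ∈ Finset.range n, √(y : ℝ) :=
            Finset.sum_le_sum fun i hi => hmono (hy i (Finset.mem_range.1 hi))
        _ = n * √(y : ℝ) := by simp
        _ ≤ B * √(y : ℝ) * √(y : ℝ) := by
            refine mul_le_mul_of_nonneg_right ?_ (Real.sqrt_nonneg _)
            calc (n : ℝ) ≤ W := by exact_mod_cast hn
              _ ≤ B * √(η 0 : ℝ) := hWB
              _ ≤ B * √(y : ℝ) := mul_le_mul_of_nonneg_left (hmono hy0) hB
        _ = B * y := by rw [mul_assoc, hsq]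
    have h2 := mul_le_mul_of_nonneg_left h1 hD
    have h3 := mul_nonneg (mul_nonneg hD hB) (sub_nonneg.2 hy0')
    have h4 := logCount_nonneg fun i : Fin n => η i
    linarith
  · obtain ⟨k, rfl⟩ := Nat.exists_eq_add_of_lt hn
    rw [add_assoc] at hn hy ⊢
    have h1 := logCount_add_le fun i : Fin (W + (k + 1)) => η i
    have h2 := hWη (fun i => η i) fun i => hη (Nat.zero_le _)
    have h3 := ih (k + 1) (by omega) (fun i => η (W + i)) (fun a b hab => hη (by omega))
      (hH.trans (hη (Nat.zero_le _))) (hy _ (by omega)) fun i hi => hy _ (by omega)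
    have h4 : ∑ i ∈ Finset.range W, √(η i : ℝ) ≤ W * √(η 0 : ℝ) + B * (η W - η 0) := by
      have h0 : √(η 0 : ℝ) ≤ √(η W : ℝ) := hmono (hη (Nat.zero_le _))
      calc ∑ i ∈ Finset.range W, √(η i : ℝ) ≤ ∑ i ∈ Finset.range W, √(η W : ℝ) :=
            Finset.sum_le_sum fun i hi => hmono (hη (Finset.mem_range.1 hi).le)
        _ = W * √(η 0 : ℝ) + W * (√(η W : ℝ) - √(η 0 : ℝ)) := by
            rw [Finset.sum_const, Finset.card_range, nsmul_eq_mul]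
            ring
        _ ≤ W * √(η 0 : ℝ) + B * √(η 0 : ℝ) * (√(η W : ℝ) - √(η 0 : ℝ)) := by
            gcongr
        _ ≤ W * √(η 0 : ℝ) + B * (η W - η 0) := by
            rw [mul_assoc]
            gcongr
            nlinarith [Real.sqrt_nonneg (η W : ℝ), hsq (η W), hsq (η 0)]
    have h5 := mul_le_mul_of_nonneg_left h4 hD
    rw [Finset.sum_range_add, mul_add]
    simp only [Fin.val_castAdd, Fin.val_natAdd] at h1
    rw [add_zero] at h3
    linarith

/-- The lower bound for non-decreasing heights up to `y`, with an error term linear in `y`. -/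
theorem exists_lower_bound {ε : ℝ} (hε : 0 < ε) (hεσ : ε < gammaPlus / 2) :
    ∃ C : ℝ, 0 ≤ C ∧ ∃ H : ℕ, ∀ (n : ℕ) (η : ℕ → ℕ) (y : ℕ), Monotone η → H ≤ η 0 → η 0 ≤ y →
      (∀ i < n, η i ≤ y) → (gammaPlus - ε) * ∑ i ∈ Finset.range n, √(η i : ℝ)
        ≤ (logCount fun i : Fin n => η i) + C * y := by
  obtain ⟨B, hB, H, hblock⟩ := exists_block hε hεσ
  have hD : 0 ≤ gammaPlus - ε := by linarith [gammaPlus_pos]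
  refine ⟨(gammaPlus - ε) * B * 2, by positivity, H, fun n η y hη hH hy0 hy => ?_⟩
  have h1 := mul_sum_sqrt_le_of_blocks hD hB hblock y n η hη hH hy0 hy
  have h2 : 0 ≤ (gammaPlus - ε) * B * η 0 := by positivity
  linarith

/-! ### Asymptotics -/

/-- An exact upper bound and a lower bound up to `2 * ε` suffice for the asymptotic equivalence. -/
theorem isEquivalent_gammaPlus_mul {L S : ℕ+ → ℝ} (hS : ∀ x, 0 ≤ S x)
    (hle : ∀ x, L x ≤ gammaPlus * S x)
    (hge : ∀ ε, 0 < ε → ε < gammaPlus / 2 → ∀ᶠ x in atTop, (gammaPlus - 2 * ε) * S x ≤ L x) :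
    L ~[atTop] fun x => gammaPlus * S x := by
  refine isLittleO_iff.2 fun c hc => ?_
  have hγ := gammaPlus_pos
  have hc' : 0 < min (c * gammaPlus / 2) (gammaPlus / 4) := by positivity
  filter_upwards [hge _ hc' (by linarith [min_le_right (c * gammaPlus / 2) (gammaPlus / 4)])]
    with x hx
  have h1 := mul_le_mul_of_nonneg_right (min_le_left (c * gammaPlus / 2) (gammaPlus / 4)) (hS x)
  rw [Pi.sub_apply, Real.norm_of_nonpos (by linarith [hle x]),
    Real.norm_of_nonneg (mul_nonneg hγ.le (hS x))]
  linarith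

theorem eventually_le_of_one_isLittleO_sqrt {h : ℕ+ → ℕ+}
    (hh : (fun _ => (1 : ℝ)) =o[atTop] fun x => √(h x : ℝ)) (H : ℕ) :
    ∀ᶠ x in atTop, H ≤ (h x : ℕ) := by
  filter_upwards [isLittleO_iff.1 hh (c := 1 / ((H : ℝ) + 1)) (by positivity)] with x hx
  rw [norm_one, Real.norm_of_nonneg (Real.sqrt_nonneg _), one_div_mul_eq_div,
    le_div_iff₀ (by positivity), one_mul] at hx
  have h1 := Real.mul_self_sqrt (Nat.cast_nonneg (α := ℝ) (h x))
  have h2 : (H : ℝ) ≤ (h x : ℕ) := by nlinarith [(Nat.cast_nonneg H : (0 : ℝ) ≤ H)]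
  exact_mod_cast h2

theorem isGammaPlus_gammaPlus : IsGammaPlus gammaPlus := by
  refine ⟨gammaPlus_pos, fun h w hh hw => ?_⟩
  simp_rw [mul_assoc]
  refine isEquivalent_gammaPlus_mul (fun x => by positivity) (fun x => ?_) fun ε hε hεσ => ?_
  · have := logCount_le_gammaPlus_mul (fun _ : Fin (w x) => (h x : ℕ)) (fun _ _ _ => le_rfl)
      fun _ => (h x).pos
    simpa [rectLogCount] using this
  · obtain ⟨C, hC, H, hlow⟩ := exists_lower_bound hε hεσ
    filter_upwards [eventually_le_of_one_isLittleO_sqrt hh H,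
      isLittleO_iff.1 hw (c := ε / (C + 1)) (by positivity)] with x hx1 hx2
    have h1 := hlow (w x) (fun _ => h x) (h x) (fun _ _ _ => le_rfl) hx1 le_rfl fun _ _ => le_rfl
    rw [Finset.sum_const, Finset.card_range, nsmul_eq_mul] at h1
    rw [Real.norm_of_nonneg (Real.sqrt_nonneg _), Real.norm_of_nonneg (by positivity),
      div_mul_eq_mul_div, le_div_iff₀ (by positivity)] at hx2
    have h2 := Real.mul_self_sqrt (Nat.cast_nonneg (α := ℝ) (h x))
    have h3 := mul_le_mul_of_nonneg_right hx2 (Real.sqrt_nonneg (h x : ℝ))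
    have h4 : (0 : ℝ) ≤ (h x : ℕ) := by positivity
    have h5 : C * (h x : ℕ) ≤ ε * ((w x : ℕ) * √((h x : ℕ) : ℝ)) := by nlinarith
    rw [rectLogCount]
    linarith

theorem sum_Icc_one_eq_sum_range (f : ℕ+ → ℝ) (n : ℕ+) :
    ∑ i ∈ Finset.Icc 1 n, f i = ∑ i ∈ Finset.range n, f (Nat.succPNat i) := by
  refine Finset.sum_bij' (fun i _ => i.natPred) (fun i _ => Nat.succPNat i) ?_ ?_ ?_ ?_ ?_
  · intro i hi
    have h1 : (i : ℕ) ≤ n := (Finset.mem_Icc.1 hi).2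
    have h2 := i.natPred_add_one
    rw [Finset.mem_range]
    omega
  · intro i hi
    refine Finset.mem_Icc.2 ⟨one_le, ?_⟩
    rw [← PNat.coe_le_coe, Nat.succPNat_coe]
    exact Finset.mem_range.1 hi
  · intro i _
    exact PNat.succPNat_natPred i
  · intro i _
    exact Nat.natPred_succPNat i
  · intro i _
    rw [PNat.succPNat_natPred]

end Kostant

theorem mainTheorem6 :
    ∃ γ : ℝ, Kostant.IsGammaPlus γ ∧
      ∀ η : ℕ+ → ℕ+, Monotone η →
        ((fun n : ℕ+ => √(η n : ℝ)) =o[atTop] fun n : ℕ+ => (n : ℝ)) →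
        ((fun _ : ℕ+ => (1 : ℝ)) =o[atTop] fun n : ℕ+ => √(η n : ℝ)) →
        ((fun n : ℕ+ => (η n : ℝ)) =o[atTop]
          fun n : ℕ+ => ∑ i ∈ Finset.Icc 1 n, √(η i : ℝ)) →
        (fun n : ℕ+ => Kostant.initialLogCount η n) ~[atTop]
          fun n : ℕ+ => γ * ∑ i ∈ Finset.Icc 1 n, √(η i : ℝ) := by
  refine ⟨Kostant.gammaPlus, Kostant.isGammaPlus_gammaPlus, fun η hη _ hη1 hηS => ?_⟩
  let e : ℕ → ℕ := fun i => η (Nat.succPNat i)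
  have he : Monotone e := fun a b hab => hη (Nat.succPNat_le_succPNat.2 hab)
  have hsum : ∀ n : ℕ+, ∑ i ∈ Finset.Icc 1 n, √(η i : ℝ) = ∑ i ∈ Finset.range n, √(e i : ℝ) :=
    fun n => Kostant.sum_Icc_one_eq_sum_range (fun i => √(η i : ℝ)) n
  refine Kostant.isEquivalent_gammaPlus_mul (fun n => Finset.sum_nonneg fun _ _ =>
    Real.sqrt_nonneg _) (fun n => ?_) fun ε hε hεσ => ?_
  · rw [hsum, ← Fin.sum_univ_eq_sum_range (fun i => √(e i : ℝ))]
    exact Kostant.logCount_le_gammaPlus_mul (fun i : Fin n => e i) (fun i j hij => he hij)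
      fun i => (η _).pos
  · -- The vertices before `n₀`, whose heights may be too small, are dropped; they contribute only the
    -- constant `S₀`, which is bounded by `S₀ * η n`.
    obtain ⟨C, hC, H, hlow⟩ := Kostant.exists_lower_bound hε hεσ
    obtain ⟨n₀, hn₀⟩ := (Kostant.eventually_le_of_one_isLittleO_sqrt hη1 H).exists
    set a : ℕ := n₀.natPred with ha
    set S₀ : ℝ := ∑ i ∈ Finset.range a, √(e i : ℝ) with hS₀
    have hS₀pos : 0 ≤ S₀ := Finset.sum_nonneg fun _ _ => Real.sqrt_nonneg _
    have hγ := Kostant.gammaPlus_pos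
    filter_upwards [eventually_ge_atTop n₀, isLittleO_iff.1 hηS
      (c := ε / (C + Kostant.gammaPlus * S₀ + 1)) (by positivity)] with n hn hx
    have ha1 := n₀.natPred_add_one
    have hn' : (n₀ : ℕ) ≤ n := hn
    obtain ⟨k, hk⟩ : ∃ k, (n : ℕ) = a + (k + 1) := ⟨n - n₀, by omega⟩
    have hnk : e (a + k) = η n := by
      have : Nat.succPNat (a + k) = n := PNat.eq (by rw [Nat.succPNat_coe]; omega)
      simp only [e, this]
    have h1 := hlow (k + 1) (fun i => e (a + i)) (e (a + k)) (fun i j hij => he (by omega))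
      (by simpa only [e, add_zero, ha, PNat.succPNat_natPred] using hn₀) (he (by omega))
      (fun i hi => he (by omega))
    have h2 := Kostant.logCount_add_le (m := a) (n := k + 1) fun i => e i
    have h3 := Kostant.logCount_nonneg fun i : Fin a => e i
    have h4 : Kostant.initialLogCount η n = Kostant.logCount fun i : Fin (a + (k + 1)) => e i := by
      rw [← hk]
      rfl
    rw [Real.norm_of_nonneg (by positivity), Real.norm_of_nonneg (Finset.sum_nonneg fun _ _ =>
      Real.sqrt_nonneg _), div_mul_eq_mul_div, le_div_iff₀ (by positivity), hsum, hk,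
      Finset.sum_range_add] at hx
    rw [h4, hsum, hk, Finset.sum_range_add]
    simp only [Fin.val_castAdd, Fin.val_natAdd] at h2
    rw [hnk] at h1
    have h5 : (1 : ℝ) ≤ (η n : ℕ) := by exact_mod_cast (η n).pos
    have h6 : Kostant.gammaPlus * S₀ ≤ Kostant.gammaPlus * S₀ * (η n : ℕ) :=
      le_mul_of_one_le_right (by positivity) h5
    have h7 : 0 ≤ ε * S₀ := by positivity
    rw [← hS₀] at hx ⊢
    linarith
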